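/- Let $k\ge 1$, $r\ge 1$, $\delta\ge 2$, $t\ge 0$ and $n$ be integers with $n\ge k\,(t(r+\delta-2)+1)$. Then there are a finite field $\mathbb F$ and a linear subspace $C\subseteq\mathbb F^n$ of dimension $k$ which is a perfect linear $(n,k,d,r,\delta,t)$-LRC with information-symbol locality, that is, whose minimum Hamming distance $d$ satisfies $$d=n-k+1-\left(\left\lceil\frac{t(k-1)+1}{t(r-1)+1}\right\rceil-1\right)(\delta-1),$$ and which has an information set $K\subseteq[n]$ all of whose elements have $(r,\delta,t)$-availability. Here, for $X\subseteq[n]$, $C_X$ denotes the projection of $C$ to the coordinates in $X$; the minimum distance is $d=\min\{|X| : X\subseteq [n],\ |C_{[n]\setminus X}|<|C|\}$. A set $K\subseteq[n]$ is an information set if $|C_K|=|C|$ and $|C_{K\setminus\{i\}}|<|C|$ for every $i\in K$. A coordinate $i$ has $(r,\delta,t)$-availability if there are $t$ sets $R_1,\dots,R_t\subseteq[n]$ with $R_j\cap R_l=\{i\}$ for $j\ne l$, such that each $R=R_j$ satisfies $i\in R$, $|R|\le r+\delta-1$, and $|C_X|=|C_R|$ for every $X\subseteq R\setminus\{i\}$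 with $|X|\ge|R|-(\delta-1)$. -/

import Mathlib

namespace LRC

variable {ι A : Type*}

/-- The projection `C_X` of a code `C ⊆ A^ι` onto the coordinates in `X`. -/
def proj (C : Set (ι → A)) (X : Finset ι) : Set (X → A) :=
  (fun c => X.restrict c) '' C

/-- `d` is the minimum distance of `C`: the least size of a set `X` of coordinates such that
the projection of `C` onto the complement of `X` has fewer elements than `C`. -/
def IsMinDist [Fintype ι] [DecidableEq ι] (C : Set (ι → A)) (d : ℕ) : Prop :=
  IsLeast {m : ℕ | ∃ X : Finset ι, X.card = m ∧ (proj C Xᶜ).ncard < C.ncard} d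

/-- `R` is a local repair set with repair locality `(r, δ)` for the coordinate `i`:
`i ∈ R`, `|R| ≤ r + δ - 1`, and every `X ⊆ R \ {i}` with `|X| ≥ |R| - (δ - 1)` (an inequality
of integers, so that no small `R` qualifies vacuously) satisfies `|C_X| = |C_R|`. -/
structure IsLocalRepairSet [DecidableEq ι] (C : Set (ι → A)) (r δ : ℕ) (i : ι)
    (R : Finset ι) : Prop where
  mem : i ∈ R
  card_le : (R.card : ℤ) ≤ (r : ℤ) + δ - 1
  repair : ∀ X ⊆ R.erase i, (R.card : ℤ) - ((δ : ℤ) - 1) ≤ X.card →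
    (proj C X).ncard = (proj C R).ncard

/-- The coordinate `i` has `(r, δ, t)`-availability: there are `t` local repair sets for `i`
which pairwise meet exactly in `i`. -/
def HasAvailability [DecidableEq ι] (C : Set (ι → A)) (r δ t : ℕ) (i : ι) : Prop :=
  ∃ R : Fin t → Finset ι, (∀ j, IsLocalRepairSet C r δ i (R j)) ∧
    ∀ j l, j ≠ l → R j ∩ R l = {i}

/-- `K` is an information set of `C`. -/
def IsInformationSet [DecidableEq ι] (C : Set (ι → A)) (K : Finset ι) : Prop :=
  (proj C K).ncard = C.ncard ∧ ∀ i ∈ K, (proj C (K.erase i)).ncard < C.ncard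

/-- The subspace `C` of `F^n` is a linear `(n, k, d, r, δ, t)`-LRC with information-symbol
locality. -/
structure IsLinearLRC {F : Type*} [Field F] {n : ℕ} (C : Submodule F (Fin n → F))
    (k d r δ t : ℕ) : Prop where
  finrank_eq : Module.finrank F C = k
  minDist : IsMinDist (C : Set (Fin n → F)) d
  locality : ∃ K : Finset (Fin n), IsInformationSet (C : Set (Fin n → F)) K ∧
    ∀ i ∈ K, HasAvailability (C : Set (Fin n → F)) r δ t i

/-- The Singleton-type bound
`n - k + 1 - (⌈(t(k-1)+1) / (t(r-1)+1)⌉ - 1)(δ - 1)` for integral `k`. -/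
def singletonBound (n k r δ t : ℕ) : ℤ :=
  (n : ℤ) - k + 1 -
    (⌈((t : ℚ) * ((k : ℚ) - 1) + 1) / ((t : ℚ) * ((r : ℚ) - 1) + 1)⌉ - 1) * ((δ : ℤ) - 1)

end LRC

/-!
Let `L` be an extension of a finite field `K` with `q` elements. A codeword of the Gabidulin code of
dimension `k` with evaluation points `g` is given by a linearized polynomial of `q`-degree less than
`k`. Since the roots of such a polynomial form a `K`-subspace of dimension less than `k`, and every
such subspace is killed by one, the projection onto the coordinates in `X` loses codewords exactly
when the points `g x`, `x ∈ X`, have rank less than `k` over `K`. So the code is governed by the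
linear matroid of `g` over `K`: the minimum distance is `n - m`, where `m` is the largest size of a
set of rank less than `k`.

Start from `k` independent centres. Each of them is shared by `t` blocks with `r + δ - 2` further
elements, placed on a moment curve through the centre whose frame has `r` vectors, and these frames
are otherwise independent. Any `r` elements of a block then span it, which gives availability. Only
the blocks with at least `r` noncentral elements in `X` make `|X|` exceed the rank `ρ` of `X`, each
by at most `δ - 1`. If there are `m` of them, they contribute `m (r - 1)` to `ρ` besides their
centres, of which there are at least `m / t`, so `m (t (r - 1) + 1) ≤ t ρ`. Hence
`|X| ≤ ρ + ⌊t ρ / (t (r - 1) + 1)⌋ (δ - 1)`, and filling as many whole blocks as possible attains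
this bound; the case `ρ = k - 1` is the claim.
-/

namespace LRC

theorem finrank_image_le_card (K : Type*) {V κ : Type*} [Semiring K] [StrongRankCondition K]
    [AddCommMonoid V] [Module K V] (g : κ → V) (X : Finset κ) : (g '' X).finrank K ≤ X.card := by
  rw [Set.image_eq_range]
  simpa using finrank_range_le_card (R := K) fun x : (X : Set κ) => g x

theorem card_le_finrank_range_of_linearIndependent_comp {K V ω κ : Type*} [DivisionRing K]
    [AddCommGroup V] [Module K V] [FiniteDimensional K V] [Fintype ω] {g : κ → V} {f : ω → κ}
    (h : LinearIndependent K (g ∘ f)) : Fintype.card ω ≤ (Set.range g).finrank K := by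
  rw [← finrank_span_eq_card h]
  exact Set.finrank_mono (Set.range_comp_subset_range f g)

section LinearCodes

variable {κ F : Type*} [Field F] (C : Submodule F (κ → F))

theorem ncard_proj_eq_of_forall_vanish {X Y : Finset κ} (hXY : X ⊆ Y)
    (h : ∀ c ∈ C, (∀ x ∈ X, c x = 0) → ∀ y ∈ Y, c y = 0) :
    (proj (C : Set (κ → F)) X).ncard = (proj (C : Set (κ → F)) Y).ncard := by
  have hproj : proj (C : Set (κ → F)) X =
      Finset.restrict₂ (π := fun _ => F) hXY '' proj (C : Set (κ → F)) Y := by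
    simp only [proj, Set.image_image]
    rfl
  rw [hproj]
  refine Set.InjOn.ncard_image ?_
  rintro _ ⟨c, hc, rfl⟩ _ ⟨c', hc', rfl⟩ hcc'
  funext y
  refine sub_eq_zero.1 (h (c - c') (C.sub_mem hc hc') (fun x hx => ?_) y y.2)
  exact sub_eq_zero.2 (congrFun hcc' ⟨x, hx⟩)

theorem ncard_proj_lt_iff_exists_vanish [Finite κ] [Finite F] (X : Finset κ) :
    (proj (C : Set (κ → F)) X).ncard < (C : Set (κ → F)).ncard ↔
      ∃ c ∈ C, c ≠ 0 ∧ ∀ x ∈ X, c x = 0 := by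
  rw [proj, (Set.ncard_image_le (Set.toFinite _)).lt_iff_ne, Ne,
    Set.ncard_image_iff (Set.toFinite _), not_iff_comm]
  push Not
  constructor
  · intro h c hc c' hc' hcc'
    by_contra hne
    obtain ⟨x, hx, hx0⟩ := h (c - c') (C.sub_mem hc hc') (sub_ne_zero.2 hne)
    exact hx0 (sub_eq_zero.2 (congrFun hcc' ⟨x, hx⟩))
  · intro h c hc hc0
    by_contra! hX
    exact hc0 (h hc C.zero_mem (funext fun x => hX x x.2))

end LinearCodes

section LinearizedPolynomials

variable (K : Type*) {L : Type*} [Field K] [Fintype K] [Field L] [Algebra K L] (k : ℕ)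

/-- The linearized polynomial `∑ i < k, a i * X ^ q ^ i`, where `q = |K|`, as a `K`-linear map that
depends `L`-linearly on its coefficients `a`. -/
noncomputable def linearized : (Fin k → L) →ₗ[L] (L →ₗ[K] L) :=
  Fintype.linearCombination L fun i : Fin k =>
    (FiniteField.frobeniusAlgHom K L ^ (i : ℕ)).toLinearMap

variable {k}

theorem linearized_apply (a : Fin k → L) (x : L) :
    linearized K k a x = ∑ i, a i * x ^ Fintype.card K ^ (i : ℕ) := by
  simp [linearized, Fintype.linearCombination_apply, FiniteField.coe_frobeniusAlgHom, pow_iterate]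

variable {K} {V : Submodule K L}

theorem finrank_lt_of_le_ker_linearized [FiniteDimensional K V] {a : Fin k → L} (ha : a ≠ 0)
    (hV : V ≤ LinearMap.ker (linearized K k a)) : Module.finrank K V < k := by
  have hq : 1 < Fintype.card K := Fintype.one_lt_card
  obtain ⟨i, hi⟩ := Function.ne_iff.1 ha
  have hk := i.pos
  let P : Polynomial L := ∑ i : Fin k, Polynomial.monomial (Fintype.card K ^ (i : ℕ)) (a i)
  have hP : P ≠ 0 := fun h => hi <| by
    have : P.coeff (Fintype.card K ^ (i : ℕ)) = a i := by
      simp [P, Polynomial.finsetSum_coeff, Polynomial.coeff_monomial,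
        (Nat.pow_right_injective hq).eq_iff, Fin.val_inj]
    rw [← this, h, Polynomial.coeff_zero, Pi.zero_apply]
  have hdeg : P.natDegree ≤ Fintype.card K ^ (k - 1) :=
    Polynomial.natDegree_sum_le_of_forall_le _ _ fun i _ =>
      (Polynomial.natDegree_monomial_le _).trans (Nat.pow_le_pow_right hq.le (by omega))
  have := Module.finite_of_finite K (M := V)
  have := Fintype.ofFinite V
  have hcard : Fintype.card V ≤ P.natDegree := by
    by_contra! hlt
    refine hP (Polynomial.eq_zero_of_natDegree_lt_card_of_eval_eq_zero P Subtype.val_injective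
      (fun v : V => ?_) hlt)
    simpa [P, Polynomial.eval_finsetSum, linearized_apply] using hV v.2
  rw [Module.card_eq_pow_finrank (K := K)] at hcard
  have := (Nat.pow_le_pow_iff_right hq).1 (hcard.trans hdeg)
  omega

theorem exists_le_ker_linearized_of_finrank_lt [FiniteDimensional K V]
    (hV : Module.finrank K V < k) :
    ∃ a : Fin k → L, a ≠ 0 ∧ V ≤ LinearMap.ker (linearized K k a) := by
  let b := Module.finBasis K V
  let ev : (Fin k → L) →ₗ[L] (Fin (Module.finrank K V) → L) :=
    LinearMap.pi fun j => LinearMap.applyₗ' L (b j : L) ∘ₗ linearized K k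
  obtain ⟨a, ha, ha0⟩ := (Submodule.ne_bot_iff _).1
    (LinearMap.ker_ne_bot_of_finrank_lt (f := ev) (by simpa using hV))
  have hzero : linearized K k a ∘ₗ V.subtype = 0 := b.ext fun j => congrFun ha j
  exact ⟨a, ha0, fun v hv => LinearMap.congr_fun hzero ⟨v, hv⟩⟩

end LinearizedPolynomials

section GabidulinCodes

variable {K L : Type*} [Field K] [Fintype K] [Field L] [Algebra K L] {κ : Type*} {k : ℕ}

variable (K k) in
/-- Evaluation of the linearized polynomials with `k` coefficients at the points `g x`. -/
noncomputable def evalLinearized (g : κ → L) : (Fin k → L) →ₗ[L] (κ → L) :=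
  LinearMap.pi fun x => LinearMap.applyₗ' L (g x) ∘ₗ linearized K k

variable (K k) in
/-- The Gabidulin code of dimension `k` with evaluation points `g`. The points may be linearly
dependent over `K`: their dependencies are what creates repair sets. -/
noncomputable def gabidulinCode (g : κ → L) : Submodule L (κ → L) :=
  LinearMap.range (evalLinearized K k g)

variable {g : κ → L}

theorem forall_evalLinearized_eq_zero_iff {a : Fin k → L} {X : Set κ} :
    (∀ x ∈ X, evalLinearized K k g a x = 0) ↔
      Submodule.span K (g '' X) ≤ LinearMap.ker (linearized K k a) := by
  rw [Submodule.span_le, Set.image_subset_iff]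
  rfl

theorem ncard_proj_gabidulinCode_eq_of_subset_span {X Y : Finset κ} (hXY : X ⊆ Y)
    (h : g '' Y ⊆ Submodule.span K (g '' X)) :
    (proj (gabidulinCode K k g : Set (κ → L)) X).ncard =
      (proj (gabidulinCode K k g : Set (κ → L)) Y).ncard := by
  refine ncard_proj_eq_of_forall_vanish _ hXY ?_
  rintro _ ⟨a, rfl⟩ hX
  exact forall_evalLinearized_eq_zero_iff.2
    ((Submodule.span_le.2 h).trans (forall_evalLinearized_eq_zero_iff.1 hX))

theorem isLocalRepairSet_gabidulinCode [DecidableEq κ] {ω : Type*} [Fintype ω] {r δ : ℕ}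
    (f : ω ↪ κ) (o : ω) (hcard : Fintype.card ω + 1 ≤ r + δ)
    (h : ∀ S : Finset ω, Fintype.card ω + 1 ≤ S.card + δ →
      ∀ x, g (f x) ∈ Submodule.span K (g ∘ f '' S)) :
    IsLocalRepairSet (gabidulinCode K k g : Set (κ → L)) r δ (f o) (Finset.univ.map f) where
  mem := Finset.mem_map_of_mem f (Finset.mem_univ o)
  card_le := by
    rw [Finset.card_map, Finset.card_univ]
    omega
  repair X hX hXcard := by
    have hX' := hX.trans (Finset.erase_subset _ _)
    refine ncard_proj_gabidulinCode_eq_of_subset_span hX' ?_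
    obtain ⟨S, -, rfl⟩ := Finset.subset_map_iff.1 hX'
    rw [Finset.card_map, Finset.card_map, Finset.card_univ] at hXcard
    rintro _ ⟨_, hy, rfl⟩
    obtain ⟨x, -, rfl⟩ := Finset.mem_map.1 hy
    rw [Finset.coe_map, ← Set.image_comp]
    exact h S (by omega) x

variable [Finite L]

theorem evalLinearized_injective (hg : k ≤ (Set.range g).finrank K) :
    Function.Injective (evalLinearized K k g) := by
  rw [← LinearMap.ker_eq_bot, LinearMap.ker_eq_bot']
  intro a ha
  by_contra ha0
  refine (finrank_lt_of_le_ker_linearized ha0 ?_).not_ge hg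
  rw [← Set.image_univ, ← forall_evalLinearized_eq_zero_iff]
  exact fun x _ => congrFun ha x

theorem finrank_gabidulinCode (hg : k ≤ (Set.range g).finrank K) :
    Module.finrank L (gabidulinCode K k g) = k := by
  rw [gabidulinCode, LinearMap.finrank_range_of_inj (evalLinearized_injective hg),
    Module.finrank_fin_fun]

variable [Finite κ]

theorem ncard_proj_gabidulinCode_lt_iff (hg : k ≤ (Set.range g).finrank K) (X : Finset κ) :
    (proj (gabidulinCode K k g : Set (κ → L)) X).ncard <
        (gabidulinCode K k g : Set (κ → L)).ncard ↔
      (g '' X).finrank K < k := by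
  rw [ncard_proj_lt_iff_exists_vanish]
  constructor
  · rintro ⟨_, ⟨a, rfl⟩, ha, hX⟩
    refine finrank_lt_of_le_ker_linearized (a := a) ?_ (forall_evalLinearized_eq_zero_iff.1 hX)
    rintro rfl
    exact ha (map_zero _)
  · intro hX
    obtain ⟨a, ha, hker⟩ := exists_le_ker_linearized_of_finrank_lt hX
    exact ⟨_, LinearMap.mem_range_self _ a,
      (map_ne_zero_iff _ (evalLinearized_injective hg)).2 ha,
      forall_evalLinearized_eq_zero_iff.2 hker⟩

theorem isInformationSet_gabidulinCode [DecidableEq κ] {ω : Type*} [Fintype ω] (f : ω ↪ κ)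
    (hf : LinearIndependent K (g ∘ f)) :
    IsInformationSet (gabidulinCode K (Fintype.card ω) g : Set (κ → L)) (Finset.univ.map f) := by
  have hspan : (g '' (Finset.univ.map f : Finset κ)).finrank K = Fintype.card ω := by
    rw [Finset.coe_map, ← Set.image_comp, Finset.coe_univ, Set.image_univ]
    exact finrank_span_eq_card hf
  have hg := card_le_finrank_range_of_linearIndependent_comp hf
  constructor
  · exact eq_of_le_of_not_lt (Set.ncard_image_le (Set.toFinite _))
      (mt (ncard_proj_gabidulinCode_lt_iff hg _).1 hspan.not_lt)
  · intro i hi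
    rw [ncard_proj_gabidulinCode_lt_iff hg]
    calc (g '' ((Finset.univ.map f).erase i : Finset κ)).finrank K
        ≤ ((Finset.univ.map f).erase i).card := finrank_image_le_card K g _
      _ < (Finset.univ.map f).card := Finset.card_erase_lt_of_mem hi
      _ = Fintype.card ω := by rw [Finset.card_map, Finset.card_univ]

theorem isMinDist_gabidulinCode {κ : Type*} [Fintype κ] [DecidableEq κ] {g : κ → L}
    (hg : k ≤ (Set.range g).finrank K) {m : ℕ}
    (hm : IsGreatest {m | ∃ X : Finset κ, X.card = m ∧ (g '' X).finrank K < k} m) :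
    IsMinDist (gabidulinCode K k g : Set (κ → L)) (Fintype.card κ - m) := by
  constructor
  · obtain ⟨X, rfl, hX⟩ := hm.1
    refine ⟨Xᶜ, Finset.card_compl X, ?_⟩
    rwa [compl_compl, ncard_proj_gabidulinCode_lt_iff hg]
  · rintro _ ⟨X, rfl, hX⟩
    rw [ncard_proj_gabidulinCode_lt_iff hg] at hX
    have : Xᶜ.card ≤ m := hm.2 ⟨Xᶜ, rfl, hX⟩
    rw [Finset.card_compl] at this
    omega

end GabidulinCodes

section Counting

theorem sum_le_sum_min_add_card_mul {π : Type*} [Fintype π] {f : π → ℕ} {u w : ℕ}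
    (hf : ∀ p, f p ≤ u + w) :
    ∑ p, f p ≤ ∑ p, min (f p) u + ({p | u < f p} : Finset π).card * w := by
  rw [Finset.card_filter, Finset.sum_mul, ← Finset.sum_add_distrib]
  refine Finset.sum_le_sum fun p _ => ?_
  have := hf p
  split_ifs <;> omega

theorem card_mul_le_sum_min {π : Type*} [Fintype π] (f : π → ℕ) (u : ℕ) :
    ({p | u < f p} : Finset π).card * u ≤ ∑ p, min (f p) u := by
  rw [Finset.card_filter, Finset.sum_mul]
  refine Finset.sum_le_sum fun p _ => ?_
  split_ifs <;> omega

theorem card_le_card_mul_card_image_fst {ι τ : Type*} [DecidableEq ι] [Fintype τ]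
    (M : Finset (ι × τ)) :
    M.card ≤ Fintype.card τ * (M.image Prod.fst).card := by
  classical
  calc M.card ≤ (M.image Prod.fst).card * (M.image Prod.snd).card := by
        rw [← Finset.card_product]
        exact Finset.card_le_card Finset.subset_product
    _ ≤ (M.image Prod.fst).card * Fintype.card τ := Nat.mul_le_mul_left _ (Finset.card_le_univ _)
    _ = _ := mul_comm _ _

end Counting

section Bound

theorem ceil_div_add_one (a b : ℕ) :
    ⌈((a : ℚ) + 1) / ((b : ℚ) + 1)⌉ = ((a / (b + 1) : ℕ) : ℤ) + 1 := by
  have hb : (0 : ℚ) < b + 1 := by positivity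
  rw [Int.ceil_eq_iff, lt_div_iff₀ hb, div_le_iff₀ hb]
  have hlo := Nat.div_mul_le_self a (b + 1)
  have hhi : a + 1 ≤ a / (b + 1) * (b + 1) + (b + 1) :=
    Nat.lt_div_mul_add (a := a) (b := b + 1) (by omega)
  generalize a / (b + 1) = q at hlo hhi ⊢
  have hlo' : (q : ℚ) * (b + 1) ≤ a := by exact_mod_cast hlo
  have hhi' : (a : ℚ) + 1 ≤ q * (b + 1) + (b + 1) := by exact_mod_cast hhi
  constructor <;> push_cast <;> linarith

theorem singletonBound_eq {n k t u w : ℕ} (hk : 1 ≤ k)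
    (hle : k - 1 + t * (k - 1) / (t * u + 1) * w ≤ n) :
    ((n - (k - 1 + t * (k - 1) / (t * u + 1) * w) : ℕ) : ℤ) =
      singletonBound n k (u + 1) (w + 1) t := by
  have hceil := ceil_div_add_one (t * (k - 1)) (t * u)
  rw [Nat.cast_sub hle, singletonBound]
  obtain ⟨k, rfl⟩ : ∃ l, k = l + 1 := ⟨k - 1, by omega⟩
  simp only [Nat.add_sub_cancel] at hceil ⊢
  push_cast at hceil ⊢
  simp only [add_sub_cancel_right]
  rw [hceil]
  ring

end Bound

section MomentCurve

variable {K V : Type*} [Field K] [AddCommGroup V] [Module K V] {n : ℕ}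

/-- The moment curve `x ↦ ∑ l < n, x ^ l • v l` with frame `v`, which passes through `v 0` at the
node `0`. Any `n` of its points span the same subspace as the frame. -/
def momentCurve (v : Fin n → V) (x : K) : V := ∑ l : Fin n, x ^ (l : ℕ) • v l

theorem momentCurve_zero (v : Fin (n + 1) → V) : momentCurve v (0 : K) = v 0 := by
  simp [momentCurve, Fin.sum_univ_succ]

theorem frame_mem_span_momentCurve (v : Fin n → V) {T : Finset K} (hT : n ≤ T.card) (l : Fin n) :
    v l ∈ Submodule.span K (momentCurve v '' (T : Set K)) := by
  classical
  let c (x : K) : K := (Lagrange.basis T id x).coeff l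
  have hc (m : Fin n) : ∑ x ∈ T, c x * x ^ (m : ℕ) = if l = m then 1 else 0 := by
    have hdeg : (Polynomial.X ^ (m : ℕ) : Polynomial K).degree < T.card := by
      rw [Polynomial.degree_X_pow]
      exact_mod_cast m.2.trans_le hT
    have hinterp := Lagrange.eq_interpolate (v := id) (Set.injOn_id _) hdeg
    have := congrArg (Polynomial.coeff · (l : ℕ)) hinterp
    simp only [Lagrange.interpolate_apply, Polynomial.finsetSum_coeff, Polynomial.eval_pow,
      Polynomial.eval_X, Polynomial.coeff_C_mul, Polynomial.coeff_X_pow, Fin.val_inj, id] at this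
    simpa only [c, mul_comm] using this.symm
  have hv : v l = ∑ x ∈ T, c x • momentCurve v x := by
    simp only [momentCurve, Finset.smul_sum, smul_smul]
    rw [Finset.sum_comm]
    simp [← Finset.sum_smul, hc]
  rw [hv]
  exact Submodule.sum_mem _ fun x hx => Submodule.smul_mem _ _
    (Submodule.subset_span (Set.mem_image_of_mem _ hx))

end MomentCurve

/-- Coordinates arranged around centres indexed by `ι`: the centre `i` lies in the blocks `(i, j)`
with `j : τ`, each of which has further elements indexed by `σ`. Free coordinates, indexed by `E`,
lie in no block. -/
abbrev Coord (ι τ σ E : Type*) := ι ⊕ (Σ _ : ι × τ, σ) ⊕ E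

section Coord

variable {ι τ σ E : Type*}

/-- The block `p`, with its centre as `none`. -/
def block (p : ι × τ) : Option σ ↪ Coord ι τ σ E where
  toFun
    | none => Sum.inl p.1
    | some b => Sum.inr (Sum.inl ⟨p, b⟩)
  inj' := by
    rintro (_ | b) (_ | b') h <;> simp_all

@[simp]
theorem block_none (p : ι × τ) : (block p none : Coord ι τ σ E) = Sum.inl p.1 := rfl

@[simp]
theorem block_some (p : ι × τ) (b : σ) :
    (block p (some b) : Coord ι τ σ E) = Sum.inr (Sum.inl ⟨p, b⟩) := rfl

theorem map_block_inter_map_block [DecidableEq (Coord ι τ σ E)] [Fintype σ] (i : ι) {j l : τ}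
    (hjl : j ≠ l) :
    Finset.univ.map (block (i, j)) ∩ Finset.univ.map (block (i, l)) =
      ({Sum.inl i} : Finset (Coord ι τ σ E)) := by
  ext y
  simp only [Finset.mem_inter, Finset.mem_map, Finset.mem_univ, true_and, Finset.mem_singleton]
  constructor
  · rintro ⟨⟨_ | b, rfl⟩, ⟨_ | b', h⟩⟩ <;> simp_all
  · rintro rfl
    exact ⟨⟨none, rfl⟩, none, rfl⟩

variable [Fintype ι] [Fintype τ]

/-- The set of coordinates made up of the centres in `I`, the noncentral elements `S p` of each
block `p` and the free coordinates in `D`. -/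
def ofParts (I : Finset ι) (S : ι × τ → Finset σ) (D : Finset E) : Finset (Coord ι τ σ E) :=
  I.disjSum ((Finset.univ.sigma S).disjSum D)

theorem card_ofParts (I : Finset ι) (S : ι × τ → Finset σ) (D : Finset E) :
    (ofParts I S D).card = I.card + (∑ p, (S p).card + D.card) := by
  simp [ofParts]

theorem exists_eq_ofParts (X : Finset (Coord ι τ σ E)) : ∃ I S D, X = ofParts I S D := by
  refine ⟨X.toLeft, fun p => X.preimage (Function.Embedding.some.trans (block p))
    (Function.Embedding.injective _).injOn, X.toRight.toRight, ?_⟩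
  ext (i | ⟨p, b⟩ | x) <;> simp [ofParts]

end Coord

section PointConfiguration

variable {K V : Type*} [Field K] [AddCommGroup V] [Module K V] {ι τ σ E : Type*} {u : ℕ}

/-- The frame of the moment curve that carries the points of the block `p`. -/
def frame (β : Coord ι τ (Fin u) E → V) (p : ι × τ) : Fin (u + 1) → V :=
  Fin.cons (β (Sum.inl p.1)) fun l => β (Sum.inr (Sum.inl ⟨p, l⟩))

/-- The point configuration behind the code: the elements of each block lie on a moment curve
through the centre of the block, so that the block represents a uniform matroid of rank `u + 1`,
and blocks with a common centre are joined by parallel connection. -/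
def point (β : Coord ι τ (Fin u) E → V) (α : σ ↪ Kˣ) : Coord ι τ σ E → V
  | Sum.inl i => β (Sum.inl i)
  | Sum.inr (Sum.inl ⟨p, b⟩) => momentCurve (frame β p) (α b : K)
  | Sum.inr (Sum.inr x) => β (Sum.inr (Sum.inr x))

/-- The parameters on the moment curve of the elements of a block; the centre sits at `0`. -/
def node (α : σ ↪ Kˣ) : Option σ → K
  | none => 0
  | some b => α b

theorem node_injective (α : σ ↪ Kˣ) : Function.Injective (node α) := by
  rintro (_ | b) (_ | b') h <;>
    simp_all [node, Units.ne_zero, (Units.ne_zero _).symm, Units.val_inj]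

variable (β : Coord ι τ (Fin u) E → V) (α : σ ↪ Kˣ)

theorem point_block (p : ι × τ) (o : Option σ) :
    point β α (block p o) = momentCurve (frame β p) (node α o) := by
  cases o with
  | none => exact (momentCurve_zero (K := K) (frame β p)).symm
  | some b => rfl

variable {X : Set (Coord ι τ σ E)} {p : ι × τ} {S : Finset (Option σ)}

theorem frame_mem_span_point (hS : u < S.card) (hX : ∀ o ∈ S, block p o ∈ X) (l : Fin (u + 1)) :
    frame β p l ∈ Submodule.span K (point β α '' X) := by
  classical
  have hcurve : momentCurve (frame β p) '' ((S.image (node α) : Finset K) : Set K) ⊆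
      point β α '' X := by
    rw [Set.image_subset_iff, Finset.coe_image, Set.image_subset_iff]
    exact fun o ho => ⟨block p o, hX o ho, point_block β α p o⟩
  refine Submodule.span_mono hcurve (frame_mem_span_momentCurve _ ?_ l)
  rwa [Finset.card_image_of_injective _ (node_injective α)]

theorem point_block_mem_span_point (hS : u < S.card) (hX : ∀ o ∈ S, block p o ∈ X)
    (o : Option σ) : point β α (block p o) ∈ Submodule.span K (point β α '' X) := by
  rw [point_block]
  exact Submodule.sum_mem _ fun l _ =>
    Submodule.smul_mem _ _ (frame_mem_span_point β α hS hX l)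

section Rank

variable [Fintype τ] [FiniteDimensional K V] {β}

theorem linearIndepOn_point [Fintype ι] [Fintype σ] [Fintype E] (hβ : LinearIndependent K β)
    (hu : u ≤ Fintype.card σ) {S : ι × τ → Finset σ} (hS : ∀ p, (S p).card ≤ u) :
    LinearIndepOn K (point β α)
      (ofParts Finset.univ S Finset.univ : Finset (Coord ι τ σ E)) := by
  -- If every `S p` is enlarged to `u` elements, there are as many points as vectors in `β`, and
  -- they span `β`.
  choose T hST hT using fun p => Finset.exists_superset_card_eq (hS p) hu
  let Y : Finset (Coord ι τ σ E) := ofParts Finset.univ T Finset.univ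
  have hY_span : Set.range β ⊆ Submodule.span K (point β α '' Y) := by
    have hblock (p : ι × τ) (l : Fin (u + 1)) :
        frame β p l ∈ Submodule.span K (point β α '' Y) := by
      refine frame_mem_span_point β α (S := Finset.insertNone (T p)) ?_ ?_ l
      · rw [Finset.card_insertNone, hT]
        exact Nat.lt_succ_self u
      · rintro (_ | b) hb <;> simp_all [Y, ofParts]
    rintro _ ⟨i | ⟨p, l⟩ | x, rfl⟩
    · exact Submodule.subset_span ⟨Sum.inl i, by simp [Y, ofParts], rfl⟩
    · exact hblock p l.succ
    · exact Submodule.subset_span ⟨Sum.inr (Sum.inr x), by simp [Y, ofParts], rfl⟩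
  have hY : LinearIndepOn K (point β α) (Y : Set (Coord ι τ σ E)) := by
    rw [LinearIndepOn, linearIndependent_iff_card_le_finrank_span, ← Set.image_eq_range]
    calc Fintype.card (Y : Set (Coord ι τ σ E))
        = Fintype.card (Coord ι τ (Fin u) E) := by simp [Y, card_ofParts, hT]
      _ = (Set.range β).finrank K := (finrank_span_eq_card hβ).symm
      _ ≤ (point β α '' Y).finrank K := Submodule.finrank_mono (Submodule.span_le.2 hY_span)
  refine hY.mono ?_
  rintro (i | ⟨p, b⟩ | x) h
  · simp [Y, ofParts]
  · have hb : b ∈ S p := by simpa [ofParts] using h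
    simpa [Y, ofParts] using hST p hb
  · simp [Y, ofParts]

theorem card_le_finrank_point_ofParts [Fintype ι] [Fintype σ] [Finite E] [DecidableEq ι]
    (hβ : LinearIndependent K β) (hu : u ≤ Fintype.card σ)
    (I : Finset ι) (S : ι × τ → Finset σ) (D : Finset E) :
    (I ∪ ({p | u < (S p).card} : Finset (ι × τ)).image Prod.fst).card +
      (∑ p, min (S p).card u + D.card) ≤ (point β α '' (ofParts I S D)).finrank K := by
  have := Fintype.ofFinite E
  -- Keep at most `u` noncentral elements of each block. If there were more than `u`, they span the
  -- centre, which can therefore be added.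
  choose T hTS hT using fun p => Finset.exists_subset_card_eq (min_le_left (S p).card u)
  let Y := ofParts (I ∪ ({p | u < (S p).card} : Finset (ι × τ)).image Prod.fst) T D
  have hY : LinearIndepOn K (point β α) (Y : Set (Coord ι τ σ E)) := by
    refine (linearIndepOn_point α hβ hu (S := T)
      fun p => (hT p).trans_le (min_le_right _ _)).mono ?_
    rintro (i | ⟨p, b⟩ | x) h <;> simp_all [Y, ofParts]
  have hY_span : point β α '' Y ⊆ Submodule.span K (point β α '' (ofParts I S D)) := by
    rintro _ ⟨y, hy, rfl⟩
    obtain i | ⟨p, b⟩ | x := y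
    · obtain hi | hi := Finset.mem_union.1 (Finset.inl_mem_disjSum.1 hy)
      · exact Submodule.subset_span ⟨Sum.inl i, by simpa [ofParts] using hi, rfl⟩
      · obtain ⟨p, hp, rfl⟩ := Finset.mem_image.1 hi
        refine point_block_mem_span_point β α (S := (S p).map Function.Embedding.some)
          (by simpa using hp) (fun o ho => ?_) none
        obtain ⟨b, hb, rfl⟩ := Finset.mem_map.1 ho
        simpa [ofParts] using hb
    · have hb : b ∈ T p := by simpa [Y, ofParts] using hy
      exact Submodule.subset_span ⟨_, by simpa [ofParts] using hTS p hb, rfl⟩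
    · exact Submodule.subset_span ⟨Sum.inr (Sum.inr x), by simpa [Y, ofParts] using hy, rfl⟩
  calc _ = Y.card := by simp only [Y, card_ofParts, hT]
    _ = (point β α '' Y).finrank K := by
      rw [Set.image_eq_range, Set.finrank, finrank_span_eq_card hY]
      simp
    _ ≤ _ := Submodule.finrank_mono (Submodule.span_le.2 hY_span)

variable [Fintype σ] {w : ℕ}

theorem card_le_finrank_point_add [Finite ι] [Finite E] (hβ : LinearIndependent K β)
    (hσ : Fintype.card σ = u + w) (X : Finset (Coord ι τ σ E)) :
    X.card ≤ (point β α '' X).finrank K +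
      Fintype.card τ * (point β α '' X).finrank K / (Fintype.card τ * u + 1) * w := by
  classical
  have := Fintype.ofFinite ι
  obtain ⟨I, S, D, rfl⟩ := exists_eq_ofParts X
  have hrank := card_le_finrank_point_ofParts α hβ (by omega) I S D
  generalize (point β α '' (ofParts I S D)).finrank K = ρ at hrank ⊢
  set t := Fintype.card τ
  set M : Finset (ι × τ) := {p | u < (S p).card}
  have hsum : ∑ p, (S p).card ≤ ∑ p, min (S p).card u + M.card * w :=
    sum_le_sum_min_add_card_mul fun p => (S p).card_le_univ.trans_eq hσ
  have hI : I.card ≤ (I ∪ M.image Prod.fst).card := Finset.card_le_card Finset.subset_union_left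
  have hM : M.card ≤ t * ρ / (t * u + 1) := by
    rw [Nat.le_div_iff_mul_le (Nat.succ_pos _)]
    calc M.card * (t * u + 1) = t * (M.card * u) + M.card := by ring
      _ ≤ t * (∑ p, min (S p).card u) + t * (I ∪ M.image Prod.fst).card := by
        gcongr
        · exact card_mul_le_sum_min _ u
        · exact (card_le_card_mul_card_image_fst M).trans (Nat.mul_le_mul_left _
            (Finset.card_le_card Finset.subset_union_right))
      _ ≤ t * ρ := by
        rw [← mul_add]
        exact Nat.mul_le_mul_left _ (by omega)
  have := Nat.mul_le_mul_right w hM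
  rw [card_ofParts]
  omega

theorem finrank_point_ofParts_le [Fintype ι] [DecidableEq (ι × τ)] (β : Coord ι τ (Fin u) E → V)
    {I : Finset ι} {M : Finset (ι × τ)} (hM : ∀ p ∈ M, p.1 ∈ I) :
    (point β α '' (ofParts I (fun p => if p ∈ M then Finset.univ else ∅) ∅ :
      Finset (Coord ι τ σ E))).finrank K ≤ I.card + M.card * u := by
  let Y : Finset (Coord ι τ (Fin u) E) := ofParts I (fun p => if p ∈ M then Finset.univ else ∅) ∅
  have hspan : point β α '' (ofParts I (fun p => if p ∈ M then Finset.univ else ∅) ∅ :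
      Finset (Coord ι τ σ E)) ⊆ (Submodule.span K (β '' Y) : Set V) := by
    rintro _ ⟨i | ⟨p, b⟩ | x, hy, rfl⟩
    · exact Submodule.subset_span ⟨Sum.inl i, by simpa [Y, ofParts] using hy, rfl⟩
    · have hp : p ∈ M := by
        by_contra hp
        simp [ofParts, hp] at hy
      have hframe (l : Fin (u + 1)) : frame β p l ∈ Submodule.span K (β '' Y) := by
        refine Submodule.subset_span ?_
        cases l using Fin.cases with
        | zero => exact ⟨Sum.inl p.1, by simpa [Y, ofParts] using hM p hp, rfl⟩
        | succ l => exact ⟨Sum.inr (Sum.inl ⟨p, l⟩), by simp [Y, ofParts, hp], rfl⟩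
      change momentCurve (frame β p) (α b : K) ∈ Submodule.span K (β '' Y)
      exact Submodule.sum_mem _ fun l _ => Submodule.smul_mem _ _ (hframe l)
    · simp [ofParts] at hy
  calc _ ≤ (β '' Y).finrank K := Submodule.finrank_mono (Submodule.span_le.2 hspan)
    _ ≤ Y.card := finrank_image_le_card K β Y
    _ = I.card + M.card * u := by simp [Y, card_ofParts, apply_ite]

theorem exists_card_eq_finrank_point_le [Fintype ι] (β : Coord ι τ (Fin u) E → V)
    (hσ : Fintype.card σ = u + w) {ρ : ℕ} (hρ : ρ ≤ Fintype.card ι) :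
    ∃ X : Finset (Coord ι τ σ E),
      X.card = ρ + Fintype.card τ * ρ / (Fintype.card τ * u + 1) * w ∧
      (point β α '' X).finrank K ≤ ρ := by
  classical
  set t := Fintype.card τ with ht
  set m := t * ρ / (t * u + 1)
  have hm : m * (t * u + 1) ≤ t * ρ := Nat.div_mul_le_self _ _
  have hmu : m * u ≤ ρ := by
    obtain h0 | h0 := Nat.eq_zero_or_pos t
    · simp [m, h0]
    · refine Nat.le_of_mul_le_mul_left ?_ h0
      linarith
  have hmt : m ≤ (ρ - m * u) * t := by
    zify [hmu] at hm ⊢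
    linarith
  -- The `m` blocks to be filled contribute `m * u` to the rank besides their centres.
  obtain ⟨I, -, hI⟩ := Finset.exists_subset_card_eq (s := (Finset.univ : Finset ι))
    (n := ρ - m * u) ((Nat.sub_le _ _).trans hρ)
  obtain ⟨M, hMI, hM⟩ := Finset.exists_subset_card_eq (s := I ×ˢ (Finset.univ : Finset τ))
    (n := m) (by rwa [Finset.card_product, hI, Finset.card_univ, ← ht])
  refine ⟨ofParts I (fun p => if p ∈ M then Finset.univ else ∅) ∅, ?_,
    (finrank_point_ofParts_le α β fun p hp => (Finset.mem_product.1 (hMI hp)).1).trans ?_⟩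
  · simp only [card_ofParts, apply_ite, Finset.card_univ, Finset.card_empty, hσ, hI, hM,
      Finset.sum_ite_mem, Finset.univ_inter, Finset.sum_const, smul_eq_mul, mul_add]
    omega
  · rw [hI, hM, Nat.sub_add_cancel hmu]

theorem isGreatest_card_finrank_point_lt [Fintype ι] [Finite E] (hβ : LinearIndependent K β)
    (hσ : Fintype.card σ = u + w) {k : ℕ} (hk : 1 ≤ k) (hkι : k ≤ Fintype.card ι) :
    IsGreatest {m | ∃ X : Finset (Coord ι τ σ E), X.card = m ∧ (point β α '' X).finrank K < k}
      (k - 1 + Fintype.card τ * (k - 1) / (Fintype.card τ * u + 1) * w) := by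
  constructor
  · obtain ⟨X, hX, hrank⟩ := exists_card_eq_finrank_point_le α β hσ (ρ := k - 1) (by omega)
    exact ⟨X, hX, by omega⟩
  · rintro _ ⟨X, rfl, hX⟩
    have hρ := Nat.le_sub_one_of_lt hX
    refine (card_le_finrank_point_add α hβ hσ X).trans ?_
    gcongr

theorem isGreatest_card_finrank_point_comp_lt [Fintype ι] [Finite E] (hβ : LinearIndependent K β)
    (hσ : Fintype.card σ = u + w) {k : ℕ} (hk : 1 ≤ k) (hkι : k ≤ Fintype.card ι) {κ : Type*}
    (φ : κ ≃ Coord ι τ σ E) :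
    IsGreatest {m | ∃ X : Finset κ, X.card = m ∧ (point β α ∘ φ '' X).finrank K < k}
      (k - 1 + Fintype.card τ * (k - 1) / (Fintype.card τ * u + 1) * w) := by
  have hφ (m : ℕ) :
      (∃ X : Finset κ, X.card = m ∧ (point β α ∘ φ '' X).finrank K < k) ↔
        ∃ X : Finset (Coord ι τ σ E), X.card = m ∧ (point β α '' X).finrank K < k :=
    φ.finsetCongr.exists_congr fun X => by simp [Set.image_image]
  simpa only [hφ] using isGreatest_card_finrank_point_lt α hβ hσ hk hkι

end Rank

section PointCode

variable {L : Type*} [Field L] [Algebra K L] [Fintype σ] {n t w k : ℕ}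
variable {β : Coord ι (Fin t) (Fin u) E → L} (α : σ ↪ Kˣ) (φ : Fin n ≃ Coord ι (Fin t) σ E)

theorem hasAvailability_gabidulinCode_point [Fintype K] (hσ : Fintype.card σ = u + w) (i : ι) :
    HasAvailability (gabidulinCode K k (point β α ∘ φ) : Set (Fin n → L)) (u + 1) (w + 1) t
      (φ.symm (Sum.inl i)) := by
  classical
  refine ⟨fun j => Finset.univ.map ((block (i, j)).trans φ.symm.toEmbedding), fun j => ?_,
    fun j l hjl => ?_⟩
  · refine isLocalRepairSet_gabidulinCode ((block (i, j)).trans φ.symm.toEmbedding)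
      none ?_ fun S hS o => ?_
    · rw [Fintype.card_option]
      omega
    · rw [Fintype.card_option] at hS
      have := point_block_mem_span_point β α (p := (i, j)) (S := S) (by omega)
        (fun o ho => Set.mem_image_of_mem _ ho) o
      simpa [Set.image_image] using this
  · simp only [← Finset.map_map]
    rw [← Finset.map_inter, map_block_inter_map_block i hjl, Finset.map_singleton]
    rfl

variable [Fintype ι] [Finite E] [Finite L]

theorem exists_isLinearLRC_eq_singletonBound [Nonempty ι] (hβ : LinearIndependent K β)
    (hσ : Fintype.card σ = u + w) (α : σ ↪ Kˣ) (φ : Fin n ≃ Coord ι (Fin t) σ E) :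
    ∃ (C : Submodule L (Fin n → L)) (d : ℕ), IsLinearLRC C (Fintype.card ι) d (u + 1) (w + 1) t ∧
      (d : ℤ) = singletonBound n (Fintype.card ι) (u + 1) (w + 1) t := by
  have := Finite.of_injective _ (algebraMap K L).injective
  have := Fintype.ofFinite K
  let f : ι ↪ Fin n := Function.Embedding.inl.trans φ.symm.toEmbedding
  have hf : LinearIndependent K ((point β α ∘ φ) ∘ f) := by
    convert hβ.comp Sum.inl Sum.inl_injective
    funext i
    simp [f, point]
  have hrank := card_le_finrank_range_of_linearIndependent_comp hf
  have hmax := isGreatest_card_finrank_point_comp_lt α hβ hσ Fintype.card_pos le_rfl φ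
  rw [Fintype.card_fin] at hmax
  obtain ⟨X, hX, -⟩ := hmax.1
  refine ⟨gabidulinCode K (Fintype.card ι) (point β α ∘ φ), _,
    ⟨finrank_gabidulinCode hrank, isMinDist_gabidulinCode hrank hmax,
      _, isInformationSet_gabidulinCode f hf, ?_⟩, ?_⟩
  · intro x hx
    obtain ⟨i, -, rfl⟩ := Finset.mem_map.1 hx
    exact hasAvailability_gabidulinCode_point α φ hσ i
  · rw [Fintype.card_fin]
    exact singletonBound_eq Fintype.card_pos (hX ▸ card_finset_fin_le X)

end PointCode

end PointConfiguration

end LRC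

theorem theorem4p5_general {K L : Type*} [Field K] [Field L] [Finite L] [Algebra K L]
    {n k r δ t : ℕ} (hk : 1 ≤ k) (hr : 1 ≤ r) (hδ : 1 ≤ δ) (hn : k * (t * (r + δ - 2) + 1) ≤ n)
    (hK : r + δ ≤ Nat.card K + 1) (hL : n ≤ Module.finrank K L + k * (t * (δ - 1))) :
    ∃ (C : Submodule L (Fin n → L)) (d : ℕ),
      LRC.IsLinearLRC C k d r δ t ∧ (d : ℤ) = LRC.singletonBound n k r δ t := by
  have := Finite.of_injective _ (algebraMap K L).injective
  have := Fintype.ofFinite K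
  classical
  obtain ⟨u, rfl⟩ : ∃ u, r = u + 1 := ⟨r - 1, by omega⟩
  obtain ⟨w, rfl⟩ : ∃ w, δ = w + 1 := ⟨δ - 1, by omega⟩
  rw [show u + 1 + (w + 1) - 2 = u + w by omega] at hn
  obtain ⟨e, rfl⟩ := Nat.exists_eq_add_of_le hn
  have hcard (s : ℕ) :
      Fintype.card (LRC.Coord (Fin k) (Fin t) (Fin s) (Fin e)) = k * (t * s + 1) + e := by
    simp only [Fintype.card_sum, Fintype.card_sigma, Fintype.card_fin, Finset.sum_const,
      Finset.card_univ, Fintype.card_prod, smul_eq_mul]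
    ring
  obtain ⟨b, hb⟩ := exists_linearIndependent_of_le_finrank (R := K) (M := L)
    (n := k * (t * u + 1) + e) (by
      have : k * (t * (u + w) + 1) = k * (t * u + 1) + k * (t * w) := by ring
      simp only [Nat.add_sub_cancel] at hL
      omega)
  have hβ := hb.comp _ (Fintype.equivFinOfCardEq (hcard u)).injective
  obtain ⟨α⟩ : Nonempty (Fin (u + w) ↪ Kˣ) := Function.Embedding.nonempty_of_card_le <| by
    rw [Fintype.card_fin, Fintype.card_units, ← Nat.card_eq_fintype_card]
    omega
  have := Fin.pos_iff_nonempty.1 hk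
  simpa using LRC.exists_isLinearLRC_eq_singletonBound hβ (Fintype.card_fin (u + w)) α
    (Fintype.equivFinOfCardEq (hcard (u + w))).symm

theorem theorem4p5 (n k r δ t : ℕ) (hk : 1 ≤ k) (hr : 1 ≤ r) (hδ : 2 ≤ δ)
    (hn : k * (t * (r + δ - 2) + 1) ≤ n) :
    ∃ (F : Type) (_ : Field F) (_ : Finite F) (C : Submodule F (Fin n → F)) (d : ℕ),
      LRC.IsLinearLRC C k d r δ t ∧ (d : ℤ) = LRC.singletonBound n k r δ t := by
  obtain ⟨p, hp, hprime⟩ := Nat.exists_infinite_primes (r + δ)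
  have := Fact.mk hprime
  have hn0 : n ≠ 0 := (Nat.mul_pos hk (Nat.succ_pos _)).trans_le hn |>.ne'
  refine ⟨GaloisField p n, inferInstance, inferInstance,
    theorem4p5_general (K := ZMod p) hk hr (by omega) hn ?_ ?_⟩
  · rw [Nat.card_zmod]
    omega
  · rw [GaloisField.finrank p hn0]
    exact Nat.le_add_right _ _
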